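/- Let $\mathbb D=\{z\in\mathbb C:|z|\le 1\}$, let $d^2z$ be Lebesgue measure and $d\mu=(1+|z|^2)^{-2}\,d^2z$ on $\mathbb D$. Put $\mathcal H_1=L^2(\mathbb D,d\mu)\oplus L^2(\mathbb D,d\mu)$ and $\mathcal H_2=L^2(\mathbb D,d^2z)\oplus L^2(\mathbb D,d^2z)$. A pair $(u,v)\in\mathcal H_1$ represents the function on the Riemann sphere equal to $u(z)$ for $|z|\le 1$ and to $v(1/z)$ for $|z|\ge 1$. Let $H^1(\mathbb D)$ be the first Sobolev space on the disk, i.e. the space of $u\in L^2(\mathbb D,d^2z)$ whose weak derivatives $\partial u/\partial x,\ \partial u/\partial y$ on the open disk belong to $L^2(\mathbb D,d^2z)$. Let $D:\mathcal H_1\supset\operatorname{dom}(D)\to\mathcal H_2$ be the unbounded operator $$D(u,v)=(\overline\partial u,\overline\partial v),\qquad \overline\partial=\frac{\partial}{\partial\bar z}=\frac12\Big(\frac{\partial}{\partial x}+i\frac{\partial}{\partial y}\Big)\ \text{(weak derivatives)},$$ $$\operatorname{dom}(D)=\{(u,v)\in\mathcal H_1:\ u,v\in H^1(\mathbb D)\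 \text{and}\ u(z)=v(1/z)\ \text{for } |z|=1\},$$ where the boundary condition is understood in the sense of $L^2$ traces on the unit circle, almost everywhere for arc length. **Proposition.** The kernel of $D$ is a one-dimensional complex vector space, and it consists exactly of the constant functions on the sphere: $\ker D=\{(u,v)\in\mathcal H_1:\ \text{there is } c\in\mathbb C \text{ with } u=v=c \text{ almost everywhere}\}$. -/

import Mathlib

noncomputable section

open MeasureTheory Filter Topology Set
open scoped ContDiff ENNReal

namespace GluedSphere

/-- The closed unit disk. -/
def disk : Set ℂ := Metric.closedBall 0 1

/-- Lebesgue measure `d²z` on the unit disk. -/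
def area : Measure ℂ := (volume : Measure ℂ).restrict disk

/-- The Fubini-Study area measure `dμ = d²z / (1 + |z|²)²` on the unit disk. -/
def fsArea : Measure ℂ := area.withDensity fun z => ENNReal.ofReal (1 / (1 + ‖z‖ ^ 2) ^ 2)

/-- Arc length on the unit circle, as a measure on the plane. -/
def arc : Measure ℂ :=
  ((volume : Measure ℝ).restrict (Ioc 0 (2 * Real.pi))).map (circleMap 0 1)

/-- Functions on the sphere: `L²(𝔻, dμ) ⊕ L²(𝔻, dμ)`, Hilbert direct sum. -/
abbrev Functions : Type := WithLp 2 (Lp ℂ 2 fsArea × Lp ℂ 2 fsArea)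

/-- `(0,1)`-forms on the sphere: `L²(𝔻, d²z) ⊕ L²(𝔻, d²z)`, Hilbert direct sum. -/
abbrev Forms : Type := WithLp 2 (Lp ℂ 2 area × Lp ℂ 2 area)

/-- `w` is the weak derivative of `u` in the (real) direction `e` on the open unit disk. -/
def IsWeakDeriv (e : ℂ) (u w : ℂ → ℂ) : Prop :=
  ∀ φ : ℂ → ℝ, ContDiff ℝ ∞ φ → HasCompactSupport φ → tsupport φ ⊆ Metric.ball 0 1 →
    ∫ z, (fderiv ℝ φ z e) • u z ∂area = - ∫ z, φ z • w z ∂area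

/-- The Sobolev space `H¹(𝔻)`: `u` and its weak derivatives `∂u/∂x` and `∂u/∂y` are in
`L²(𝔻, d²z)`. -/
def MemH1 (u : ℂ → ℂ) : Prop :=
  MemLp u 2 area ∧ (∃ w : Lp ℂ 2 area, IsWeakDeriv 1 u w) ∧
    ∃ w : Lp ℂ 2 area, IsWeakDeriv Complex.I u w

/-- `g ∈ L²(S¹)` is the trace of `u ∈ H¹(𝔻)` on the unit circle: some sequence of functions smooth
up to the boundary converges to `u` in `H¹(𝔻)` while its restrictions to the unit circle converge
to `g` in `L²(S¹)`. -/
def HasTrace (u g : ℂ → ℂ) : Prop :=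
  MemLp u 2 area ∧ MemLp g 2 arc ∧
  ∃ w₁ w₂ : Lp ℂ 2 area, IsWeakDeriv 1 u w₁ ∧ IsWeakDeriv Complex.I u w₂ ∧
  ∃ φ : ℕ → ℂ → ℂ, (∀ k, ContDiff ℝ ∞ (φ k)) ∧
    Tendsto (fun k => eLpNorm (fun z => φ k z - u z) 2 area) atTop (𝓝 0) ∧
    Tendsto (fun k => eLpNorm (fun z => fderiv ℝ (φ k) z 1 - w₁ z) 2 area) atTop (𝓝 0) ∧
    Tendsto (fun k => eLpNorm (fun z => fderiv ℝ (φ k) z Complex.I - w₂ z) 2 area) atTop (𝓝 0) ∧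
    Tendsto (fun k => eLpNorm (fun z => φ k z - g z) 2 arc) atTop (𝓝 0)

/-! ### Facts needed for the definitions to be linear and well defined -/

instance instIsFiniteMeasureArea : IsFiniteMeasure area :=
  ⟨by simp [area, disk]⟩

theorem area_ac : area ≪ fsArea := by
  refine withDensity_absolutelyContinuous' (by fun_prop) (ae_of_all _ fun z => ?_)
  have : (0 : ℝ) < 1 / (1 + ‖z‖ ^ 2) ^ 2 := by positivity
  exact (ENNReal.ofReal_pos.2 this).ne'

theorem integrable_smul_area {φ : ℂ → ℝ} (hφ : Continuous φ) (hc : HasCompactSupport φ)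
    {u : ℂ → ℂ} (hu : MemLp u 2 area) : Integrable (fun z => φ z • u z) area := by
  have h1 : Integrable u area := hu.integrable (by norm_num)
  obtain ⟨C, hC⟩ := hφ.bounded_above_of_compact_support hc
  exact h1.bdd_smul C hφ.aestronglyMeasurable (ae_of_all _ hC)

theorem IsWeakDeriv.congr {e : ℂ} {u u' w w' : ℂ → ℂ} (h : IsWeakDeriv e u w)
    (hu : u =ᵐ[area] u') (hw : w =ᵐ[area] w') : IsWeakDeriv e u' w' := by
  intro φ h1 h2 h3
  have := h φ h1 h2 h3
  rw [integral_congr_ae (f := fun z => (fderiv ℝ φ z e) • u z)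
      (g := fun z => (fderiv ℝ φ z e) • u' z)
      (hu.mono fun z hz => by simp only [hz]),
    integral_congr_ae (f := fun z => φ z • w z) (g := fun z => φ z • w' z)
      (hw.mono fun z hz => by simp only [hz])] at this
  exact this

theorem IsWeakDeriv.add {e : ℂ} {u u' w w' : ℂ → ℂ} (h : IsWeakDeriv e u w)
    (h' : IsWeakDeriv e u' w') (hu : MemLp u 2 area) (hu' : MemLp u' 2 area)
    (hw : MemLp w 2 area) (hw' : MemLp w' 2 area) :
    IsWeakDeriv e (u + u') (w + w') := by
  intro φ h1 h2 h3
  have hd : Continuous fun z => fderiv ℝ φ z e :=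
    (h1.continuous_fderiv (by simp)).clm_apply continuous_const
  have hdc : HasCompactSupport fun z => fderiv ℝ φ z e := h2.fderiv_apply (𝕜 := ℝ) e
  simp only [Pi.add_apply, smul_add]
  rw [integral_add (integrable_smul_area hd hdc hu) (integrable_smul_area hd hdc hu'),
    integral_add (integrable_smul_area h1.continuous h2 hw)
      (integrable_smul_area h1.continuous h2 hw'), h φ h1 h2 h3, h' φ h1 h2 h3, neg_add]

theorem IsWeakDeriv.const_smul {e : ℂ} {u w : ℂ → ℂ} (h : IsWeakDeriv e u w) (c : ℂ) :
    IsWeakDeriv e (c • u) (c • w) := by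
  intro φ h1 h2 h3
  simp only [Pi.smul_apply, smul_comm _ c]
  rw [integral_smul, integral_smul, h φ h1 h2 h3, smul_neg]

/-- Weak derivatives are unique. -/
theorem IsWeakDeriv.unique {e : ℂ} {u : ℂ → ℂ} {w w' : Lp ℂ 2 area} (h : IsWeakDeriv e u w)
    (h' : IsWeakDeriv e u w') : w = w' := by
  have hi : Integrable (fun z => w z - w' z) area :=
    ((Lp.memLp w).integrable (by norm_num)).sub ((Lp.memLp w').integrable (by norm_num))
  have key : ∀ᵐ z ∂(volume : Measure ℂ), z ∈ Metric.ball (0 : ℂ) 1 → w z - w' z = 0 := by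
    refine Metric.isOpen_ball.ae_eq_zero_of_integral_contDiff_smul_eq_zero ?_ ?_
    · exact (IntegrableOn.mono_set hi Metric.ball_subset_closedBall).locallyIntegrableOn
    · intro φ h1 h2 h3
      have e1 : ∫ z, φ z • (w z - w' z) ∂area = 0 := by
        simp only [smul_sub]
        rw [integral_sub (integrable_smul_area h1.continuous h2 (Lp.memLp w))
          (integrable_smul_area h1.continuous h2 (Lp.memLp w'))]
        have := (h φ h1 h2 h3).symm.trans (h' φ h1 h2 h3)
        rw [neg_inj] at this
        rw [this, sub_self]
      rw [← e1]
      symm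
      refine setIntegral_eq_integral_of_forall_compl_eq_zero fun z hz => ?_
      have : φ z = 0 := by
        by_contra hne
        exact hz (Metric.ball_subset_closedBall (h3 (subset_tsupport _ hne)))
      simp [this]
  apply Lp.ext
  have hball : area = (volume : Measure ℂ).restrict (Metric.ball 0 1) := by
    unfold area disk
    refine Measure.restrict_congr_set ?_
    refine (ae_eq_of_subset_of_measure_ge Metric.ball_subset_closedBall ?_
      measurableSet_ball.nullMeasurableSet measure_closedBall_lt_top.ne).symm
    rw [Measure.addHaar_closedBall_eq_addHaar_ball]
  have := (ae_restrict_iff' (measurableSet_ball (x := (0 : ℂ)) (ε := 1))).2 key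
  rw [← hball] at this
  filter_upwards [this] with z hz using sub_eq_zero.1 hz

theorem MemH1.congr {u u' : ℂ → ℂ} (h : MemH1 u) (hu : u =ᵐ[area] u') : MemH1 u' :=
  ⟨h.1.ae_eq hu, h.2.1.imp fun _ hw => hw.congr hu .rfl, h.2.2.imp fun _ hw => hw.congr hu .rfl⟩

theorem IsWeakDeriv.add_Lp {e : ℂ} {u u' : ℂ → ℂ} {w w' : Lp ℂ 2 area} (h : IsWeakDeriv e u w)
    (h' : IsWeakDeriv e u' w') (hu : MemLp u 2 area) (hu' : MemLp u' 2 area) :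
    IsWeakDeriv e (u + u') (w + w' : Lp ℂ 2 area) :=
  (h.add h' hu hu' (Lp.memLp w) (Lp.memLp w')).congr .rfl (Lp.coeFn_add w w').symm

theorem IsWeakDeriv.smul_Lp {e : ℂ} {u : ℂ → ℂ} {w : Lp ℂ 2 area} (h : IsWeakDeriv e u w)
    (c : ℂ) : IsWeakDeriv e (c • u) (c • w : Lp ℂ 2 area) :=
  (h.const_smul c).congr .rfl (Lp.coeFn_smul c w).symm

theorem isWeakDeriv_zero (e : ℂ) : IsWeakDeriv e 0 (0 : Lp ℂ 2 area) := by
  have h : IsWeakDeriv e 0 0 := fun φ _ _ _ => by simp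
  exact h.congr .rfl (Lp.coeFn_zero ℂ 2 area).symm

theorem coeFn_add_area (u v : Lp ℂ 2 fsArea) : ⇑u + ⇑v =ᵐ[area] ⇑(u + v) :=
  EventuallyEq.symm (area_ac.ae_eq (Lp.coeFn_add u v))

theorem coeFn_smul_area (c : ℂ) (u : Lp ℂ 2 fsArea) : c • ⇑u =ᵐ[area] ⇑(c • u) :=
  EventuallyEq.symm (area_ac.ae_eq (Lp.coeFn_smul c u))

theorem coeFn_zero_area : (0 : ℂ → ℂ) =ᵐ[area] ⇑(0 : Lp ℂ 2 fsArea) :=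
  EventuallyEq.symm (area_ac.ae_eq (Lp.coeFn_zero ℂ 2 fsArea))

theorem HasTrace.congr {u u' g : ℂ → ℂ} (h : HasTrace u g) (hu : u =ᵐ[area] u') :
    HasTrace u' g := by
  obtain ⟨h0, hg, w₁, w₂, h1, h2, φ, hφ, t0, t1, t2, t3⟩ := h
  refine ⟨h0.ae_eq hu, hg, w₁, w₂, h1.congr hu .rfl, h2.congr hu .rfl, φ, hφ, ?_, t1, t2, t3⟩
  refine t0.congr fun k => eLpNorm_congr_ae ?_
  filter_upwards [hu] with z hz
  rw [hz]

theorem tendsto_eLpNorm_add {ν : Measure ℂ} {f F G : ℕ → ℂ → ℂ} {a b c : ℂ → ℂ}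
    (hF : ∀ k, AEStronglyMeasurable (fun z => F k z - a z) ν)
    (hG : ∀ k, AEStronglyMeasurable (fun z => G k z - b z) ν)
    (h : ∀ k, f k = F k + G k) (hc : c =ᵐ[ν] a + b)
    (t : Tendsto (fun k => eLpNorm (fun z => F k z - a z) 2 ν) atTop (𝓝 0))
    (t' : Tendsto (fun k => eLpNorm (fun z => G k z - b z) 2 ν) atTop (𝓝 0)) :
    Tendsto (fun k => eLpNorm (fun z => f k z - c z) 2 ν) atTop (𝓝 0) := by
  have ts := t.add t'
  rw [add_zero] at ts
  refine tendsto_of_tendsto_of_tendsto_of_le_of_le tendsto_const_nhds ts (fun _ => zero_le) ?_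
  intro k
  refine le_trans (le_of_eq (eLpNorm_congr_ae ?_))
    (eLpNorm_add_le (hF k) (hG k) (by norm_num : (1 : ℝ≥0∞) ≤ 2))
  filter_upwards [hc] with z hz
  simp only [h k, hz, Pi.add_apply]
  ring

theorem tendsto_eLpNorm_smul {ν : Measure ℂ} {f F : ℕ → ℂ → ℂ} {a b : ℂ → ℂ} (c : ℂ)
    (h : ∀ k, f k = c • F k) (hb : b =ᵐ[ν] c • a)
    (t : Tendsto (fun k => eLpNorm (fun z => F k z - a z) 2 ν) atTop (𝓝 0)) :
    Tendsto (fun k => eLpNorm (fun z => f k z - b z) 2 ν) atTop (𝓝 0) := by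
  have ts := ENNReal.Tendsto.const_mul (a := ‖c‖ₑ) t (Or.inr enorm_ne_top)
  rw [mul_zero] at ts
  refine ts.congr fun k => ?_
  rw [← eLpNorm_const_smul]
  refine eLpNorm_congr_ae ?_
  filter_upwards [hb] with z hz
  simp only [h k, hz, Pi.smul_apply, smul_eq_mul]
  ring

theorem HasTrace.add {u u' g g' : ℂ → ℂ} (h : HasTrace u g) (h' : HasTrace u' g') :
    HasTrace (u + u') (g + g') := by
  obtain ⟨h0, hg, w₁, w₂, h1, h2, φ, hφ, t0, t1, t2, t3⟩ := h
  obtain ⟨h0', hg', w₁', w₂', h1', h2', φ', hφ', t0', t1', t2', t3'⟩ := h'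
  have hd : ∀ {ψ : ℂ → ℂ} (e : ℂ), ContDiff ℝ ∞ ψ → Continuous fun z => fderiv ℝ ψ z e :=
    fun e hψ => (hψ.continuous_fderiv (by simp)).clm_apply continuous_const
  have hadd : ∀ (e : ℂ) k, (fun z => fderiv ℝ (φ k + φ' k) z e) =
      (fun z => fderiv ℝ (φ k) z e) + fun z => fderiv ℝ (φ' k) z e := fun e k => by
    funext z
    rw [fderiv_add ((hφ k).differentiable (by simp) z) ((hφ' k).differentiable (by simp) z)]
    rfl
  refine ⟨h0.add h0', hg.add hg', w₁ + w₁', w₂ + w₂', h1.add_Lp h1' h0 h0', h2.add_Lp h2' h0 h0',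
    fun k => φ k + φ' k, fun k => (hφ k).add (hφ' k), ?_, ?_, ?_, ?_⟩
  · exact tendsto_eLpNorm_add
      (fun k => (hφ k).continuous.aestronglyMeasurable.sub h0.1)
      (fun k => (hφ' k).continuous.aestronglyMeasurable.sub h0'.1) (fun _ => rfl) .rfl t0 t0'
  · exact tendsto_eLpNorm_add
      (fun k => (hd 1 (hφ k)).aestronglyMeasurable.sub (Lp.memLp w₁).1)
      (fun k => (hd 1 (hφ' k)).aestronglyMeasurable.sub (Lp.memLp w₁').1) (hadd 1)
      (Lp.coeFn_add _ _) t1 t1'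
  · exact tendsto_eLpNorm_add
      (fun k => (hd _ (hφ k)).aestronglyMeasurable.sub (Lp.memLp w₂).1)
      (fun k => (hd _ (hφ' k)).aestronglyMeasurable.sub (Lp.memLp w₂').1) (hadd _)
      (Lp.coeFn_add _ _) t2 t2'
  · exact tendsto_eLpNorm_add
      (fun k => (hφ k).continuous.aestronglyMeasurable.sub hg.1)
      (fun k => (hφ' k).continuous.aestronglyMeasurable.sub hg'.1) (fun _ => rfl) .rfl t3 t3'

theorem HasTrace.const_smul {u g : ℂ → ℂ} (h : HasTrace u g) (c : ℂ) :
    HasTrace (c • u) (c • g) := by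
  obtain ⟨h0, hg, w₁, w₂, h1, h2, φ, hφ, t0, t1, t2, t3⟩ := h
  have hsm : ∀ (e : ℂ) k, (fun z => fderiv ℝ (c • φ k) z e) =
      c • fun z => fderiv ℝ (φ k) z e := fun e k => by
    funext z
    rw [fderiv_const_smul ((hφ k).differentiable (by simp) z)]
    rfl
  exact ⟨h0.const_smul c, hg.const_smul c, c • w₁, c • w₂, h1.smul_Lp c, h2.smul_Lp c,
    fun k => c • φ k, fun k => (hφ k).const_smul c,
    tendsto_eLpNorm_smul c (fun _ => rfl) .rfl t0,
    tendsto_eLpNorm_smul c (hsm 1) (Lp.coeFn_smul _ _) t1,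
    tendsto_eLpNorm_smul c (hsm _) (Lp.coeFn_smul _ _) t2,
    tendsto_eLpNorm_smul c (fun _ => rfl) .rfl t3⟩

theorem hasTrace_zero : HasTrace 0 0 := by
  refine ⟨MemLp.zero, MemLp.zero, 0, 0, isWeakDeriv_zero _, isWeakDeriv_zero _, fun _ => 0,
    fun _ => contDiff_const, by simp, ?_, ?_, by simp⟩ <;>
  · refine tendsto_const_nhds.congr fun k => ?_
    rw [← eLpNorm_zero (ε := ℂ) (p := 2) (μ := area)]
    refine eLpNorm_congr_ae ?_
    filter_upwards [Lp.coeFn_zero ℂ 2 area] with z hz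
    have h0 : fderiv ℝ (0 : ℂ → ℂ) z = 0 := by simp
    rw [h0, hz]
    simp

/-! ### The operator -/

/-- `H¹(𝔻)` as a subspace of `L²(𝔻, dμ)`. -/
def H1 : Submodule ℂ (Lp ℂ 2 fsArea) where
  carrier := {u | MemH1 u}
  zero_mem' := MemH1.congr ⟨MemLp.zero, ⟨0, isWeakDeriv_zero _⟩, ⟨0, isWeakDeriv_zero _⟩⟩
    coeFn_zero_area
  add_mem' := by
    rintro u v ⟨hu, ⟨w, hw⟩, ⟨x, hx⟩⟩ ⟨hu', ⟨w', hw'⟩, ⟨x', hx'⟩⟩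
    exact MemH1.congr ⟨hu.add hu', ⟨w + w', hw.add_Lp hw' hu hu'⟩,
      ⟨x + x', hx.add_Lp hx' hu hu'⟩⟩ (coeFn_add_area u v)
  smul_mem' := by
    rintro c u ⟨hu, ⟨w, hw⟩, ⟨x, hx⟩⟩
    exact MemH1.congr ⟨hu.const_smul c, ⟨c • w, hw.smul_Lp c⟩, ⟨c • x, hx.smul_Lp c⟩⟩
      (coeFn_smul_area c u)

/-- The weak partial derivative `∂/∂x : H¹(𝔻) → L²(𝔻, d²z)`. -/
def partialX : H1 →ₗ[ℂ] Lp ℂ 2 area where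
  toFun u := u.2.2.1.choose
  map_add' u v := (u + v).2.2.1.choose_spec.unique <|
    (u.2.2.1.choose_spec.add_Lp v.2.2.1.choose_spec u.2.1 v.2.1).congr (coeFn_add_area _ _) .rfl
  map_smul' c u := (c • u).2.2.1.choose_spec.unique <|
    (u.2.2.1.choose_spec.smul_Lp c).congr (coeFn_smul_area _ _) .rfl

/-- The weak partial derivative `∂/∂y : H¹(𝔻) → L²(𝔻, d²z)`. -/
def partialY : H1 →ₗ[ℂ] Lp ℂ 2 area where
  toFun u := u.2.2.2.choose
  map_add' u v := (u + v).2.2.2.choose_spec.unique <|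
    (u.2.2.2.choose_spec.add_Lp v.2.2.2.choose_spec u.2.1 v.2.1).congr (coeFn_add_area _ _) .rfl
  map_smul' c u := (c • u).2.2.2.choose_spec.unique <|
    (u.2.2.2.choose_spec.smul_Lp c).congr (coeFn_smul_area _ _) .rfl

/-- `∂̄ = ∂/∂z̄ = (∂/∂x + i ∂/∂y) / 2` on `H¹(𝔻)`. -/
def dbar : H1 →ₗ[ℂ] Lp ℂ 2 area := (1 / 2 : ℂ) • (partialX + Complex.I • partialY)

/-- The domain of the glued operator: pairs `(u, v)` with `u, v ∈ H¹(𝔻)` and `u(z) = v(1/z)` on the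
unit circle, in the sense of traces. -/
def dom : Submodule ℂ Functions where
  carrier := {x | x.fst ∈ H1 ∧ x.snd ∈ H1 ∧ ∃ g h : ℂ → ℂ, HasTrace x.fst g ∧ HasTrace x.snd h ∧
    ∀ᵐ z ∂arc, g z = h (1 / z)}
  zero_mem' := ⟨H1.zero_mem, H1.zero_mem, 0, 0, hasTrace_zero.congr coeFn_zero_area,
    hasTrace_zero.congr coeFn_zero_area, ae_of_all _ fun _ => rfl⟩
  add_mem' := by
    rintro x y ⟨hu, hv, g, h, hg, hh, hgh⟩ ⟨hu', hv', g', h', hg', hh', hgh'⟩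
    refine ⟨H1.add_mem hu hu', H1.add_mem hv hv', g + g', h + h',
      (hg.add hg').congr (coeFn_add_area _ _), (hh.add hh').congr (coeFn_add_area _ _), ?_⟩
    filter_upwards [hgh, hgh'] with z h1 h2
    simp only [Pi.add_apply, h1, h2]
  smul_mem' := by
    rintro c x ⟨hu, hv, g, h, hg, hh, hgh⟩
    refine ⟨H1.smul_mem c hu, H1.smul_mem c hv, c • g, c • h,
      (hg.const_smul c).congr (coeFn_smul_area _ _),
      (hh.const_smul c).congr (coeFn_smul_area _ _), ?_⟩
    filter_upwards [hgh] with z h1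
    simp only [Pi.smul_apply, h1]

/-- The glued d-bar operator `D(u, v) = (∂̄u, ∂̄v)` on the sphere, an unbounded operator from
functions to `(0,1)`-forms. -/
def D : Functions →ₗ.[ℂ] Forms where
  domain := dom
  toFun :=
    { toFun := fun x => WithLp.toLp 2 (dbar ⟨x.1.fst, x.2.1⟩, dbar ⟨x.1.snd, x.2.2.1⟩)
      map_add' := fun x y => by
        rw [← WithLp.toLp_add, Prod.mk_add_mk, ← map_add, ← map_add]
        rfl
      map_smul' := fun c x => by
        rw [RingHom.id_apply, ← WithLp.toLp_smul, Prod.smul_mk, ← map_smul, ← map_smul]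
        rfl }

/-- The kernel of `D`, as a subspace of the Hilbert space of functions on the sphere. -/
def kerD : Submodule ℂ Functions := (LinearMap.ker D.toFun).map D.domain.subtype

end GluedSphere

end

/-!
The proof rests on Stokes' theorem for the unit disk, `∫ 2 ∂̄F d²z = ∫ z F(z) |dz|`
(`integral_dbar_eq`), proved in polar coordinates from the divergence theorem on a rectangle.
Applying it to `F = χ φₖ`, where `φₖ` are the smooth functions that define the trace `g` of a
function `u` with `∂̄u = 0`, and letting `k → ∞`, gives `∫ 2 ∂̄χ · u d²z = ∫ z χ g |dz|` for every
smooth `χ` (`HasTrace.integral_dbar_mul_eq`).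

With `χ = zⁿ` the left-hand side vanishes, so `g` has no Fourier modes of negative frequency. If
`(u, v)` is in the kernel, with traces `g` and `h`, this holds for `h` as well, and since
`g(z) = h(1/z)` and inversion reverses frequencies, `g` has no modes of positive frequency either.
Hence `g` is a constant `c`, and so is `h`.

With `χ = zᵃ z̄ᵇ⁺¹` the identity computes all moments `∫ zᵃ z̄ᵇ u d²z` from `g = c`. The constant
function `c` has the same moments, by Stokes' theorem again, so `u = c` almost everywhere, and
likewise `v = c` (`HasTrace.ae_eq_const`). That moments determine a function, on the disk as on
the circle, is the Stone-Weierstrass theorem (`ae_eq_zero_of_moments`).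
-/

noncomputable section

open MeasureTheory Filter Topology Set
open scoped ContDiff ENNReal

namespace GluedSphere

/-! ### Stokes' theorem on the disk -/

theorem hasFDerivAt_polar (p : ℝ × ℝ) :
    HasFDerivAt (fun q : ℝ × ℝ => (q.1 : ℂ) * Complex.exp (q.2 * Complex.I))
      ((p.1 : ℂ) • (Complex.exp (p.2 * Complex.I) •
          (Complex.ofRealCLM ∘L ContinuousLinearMap.snd ℝ ℝ ℝ).smulRight Complex.I) +
        Complex.exp (p.2 * Complex.I) • (Complex.ofRealCLM ∘L ContinuousLinearMap.fst ℝ ℝ ℝ))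
      p := by
  have h1 : HasFDerivAt (fun q : ℝ × ℝ => (q.1 : ℂ))
      (Complex.ofRealCLM ∘L ContinuousLinearMap.fst ℝ ℝ ℝ) p :=
    (Complex.ofRealCLM ∘L ContinuousLinearMap.fst ℝ ℝ ℝ).hasFDerivAt
  have h2 : HasFDerivAt (fun q : ℝ × ℝ => (q.2 : ℂ) * Complex.I)
      ((Complex.ofRealCLM ∘L ContinuousLinearMap.snd ℝ ℝ ℝ).smulRight Complex.I) p :=
    ((Complex.ofRealCLM ∘L ContinuousLinearMap.snd ℝ ℝ ℝ).smulRight Complex.I).hasFDerivAt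
  exact h1.mul h2.cexp

theorem hasFDerivAt_exp_snd (p : ℝ × ℝ) :
    HasFDerivAt (fun q : ℝ × ℝ => Complex.exp (q.2 * Complex.I))
      (Complex.exp (p.2 * Complex.I) •
          (Complex.ofRealCLM ∘L ContinuousLinearMap.snd ℝ ℝ ℝ).smulRight Complex.I) p := by
  have h2 : HasFDerivAt (fun q : ℝ × ℝ => (q.2 : ℂ) * Complex.I)
      ((Complex.ofRealCLM ∘L ContinuousLinearMap.snd ℝ ℝ ℝ).smulRight Complex.I) p :=
    ((Complex.ofRealCLM ∘L ContinuousLinearMap.snd ℝ ℝ ℝ).smulRight Complex.I).hasFDerivAt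
  exact h2.cexp

/-- The rotation rule for `2 ∂̄`, with `A` in the role of the real differential: passing from the
frame `1, i` to the frame `e, i e` with `|e| = 1` costs a factor `e`. In Stokes' theorem `e, i e` is
the polar frame. -/
theorem rotate_dbar (A : ℂ →L[ℝ] ℂ) {e : ℂ} (he : ‖e‖ = 1) :
    e * (A e + Complex.I * A (Complex.I * e)) = A 1 + Complex.I * A Complex.I := by
  have h1 : A e = e.re * A 1 + e.im * A Complex.I := by
    conv_lhs => rw [show e = e.re • (1 : ℂ) + e.im • Complex.I by
      apply Complex.ext <;> simp]
    rw [map_add, map_smul, map_smul]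
    simp
  have h2 : A (Complex.I * e) = -e.im * A 1 + e.re * A Complex.I := by
    conv_lhs => rw [show Complex.I * e = (-e.im) • (1 : ℂ) + e.re • Complex.I by
      apply Complex.ext <;> simp]
    rw [map_add, map_smul, map_smul]
    simp
  have h3 : (e.re : ℂ) ^ 2 + (e.im : ℂ) ^ 2 = 1 := by
    have := Complex.sq_norm e
    rw [he, Complex.normSq_apply] at this
    exact_mod_cast (by linarith : e.re ^ 2 + e.im ^ 2 = 1)
  rw [h1, h2]
  nth_rw 1 [← Complex.re_add_im e]
  linear_combination (A 1 + Complex.I * A Complex.I) * h3 +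
    (e.re * e.im * A Complex.I - e.im ^ 2 * A 1) * Complex.I_sq

/-- Integration over the unit disk in polar coordinates. -/
theorem integral_area_eq (H : ℂ → ℂ) :
    ∫ z, H z ∂area = ∫ p in Icc ((0, -Real.pi) : ℝ × ℝ) (1, Real.pi),
      p.1 • H (p.1 * Complex.exp (p.2 * Complex.I)) := by
  have hd : MeasurableSet disk := measurableSet_closedBall
  unfold area
  rw [← integral_indicator hd, ← Complex.integral_comp_polarCoord_symm,
    polarCoord_target]
  have h1 : ∀ p ∈ (Ioi (0 : ℝ) ×ˢ Ioo (-Real.pi) Real.pi),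
      p.1 • disk.indicator H (Complex.polarCoord.symm p) =
      ({p : ℝ × ℝ | p.1 ≤ 1}.indicator
        fun p => p.1 • H (p.1 * Complex.exp (p.2 * Complex.I))) p := by
    rintro p ⟨hp, -⟩
    have hp' : (0 : ℝ) < p.1 := hp
    have h2 : Complex.polarCoord.symm p = p.1 * Complex.exp (p.2 * Complex.I) := by
      rw [Complex.polarCoord_symm_apply, Complex.exp_mul_I]
      push_cast
      rfl
    have h3 : Complex.polarCoord.symm p ∈ disk ↔ p.1 ≤ 1 := by
      rw [disk, mem_closedBall_zero_iff, Complex.norm_polarCoord_symm, abs_of_pos hp']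
    by_cases h : p.1 ≤ 1
    · rw [indicator_of_mem (h3.2 h), indicator_of_mem (by exact h), h2]
    · rw [indicator_of_notMem (mt h3.1 h), indicator_of_notMem (by exact h), smul_zero]
  rw [setIntegral_congr_fun (measurableSet_Ioi.prod measurableSet_Ioo) h1,
    setIntegral_indicator (measurableSet_le measurable_fst measurable_const)]
  refine setIntegral_congr_set ?_
  have h4 : (Ioi (0 : ℝ) ×ˢ Ioo (-Real.pi) Real.pi) ∩ {p : ℝ × ℝ | p.1 ≤ 1} =
      Ioc (0 : ℝ) 1 ×ˢ Ioo (-Real.pi) Real.pi := by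
    ext p
    simp only [mem_inter_iff, mem_prod, mem_Ioi, mem_Ioo, mem_ofPred_eq, mem_Ioc]
    tauto
  rw [h4, ← Icc_prod_Icc]
  exact Measure.set_prod_ae_eq Ioc_ae_eq_Icc Ioo_ae_eq_Icc

/-- The interval `(0, 2π]` in the definition of arc length is moved to `(-π, π]`, the range of the
angle in Mathlib's polar coordinates. -/
theorem integral_arc_eq {F : ℂ → ℂ} (hF : AEStronglyMeasurable F arc) :
    ∫ z, F z ∂arc = ∫ θ in -Real.pi..Real.pi, F (circleMap 0 1 θ) := by
  unfold arc at *
  rw [integral_map (continuous_circleMap 0 1).aemeasurable hF,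
    ← intervalIntegral.integral_of_le (by positivity)]
  have hp : Function.Periodic (fun θ => F (circleMap 0 1 θ)) (2 * Real.pi) := fun θ => by
    simp only [periodic_circleMap 0 1 θ]
  have := hp.intervalIntegral_add_eq 0 (-Real.pi)
  rw [zero_add] at this
  rw [this]
  congr 1
  ring

/-- **Stokes' theorem** on the unit disk, `∫ 2 ∂̄F d²z = ∫ z F(z) |dz|`. In polar coordinates the
left-hand integrand times `r` is the divergence of `(r e^{iθ} F, i e^{iθ} F)`. -/
theorem integral_dbar_eq {F : ℂ → ℂ} (hF : ContDiff ℝ ∞ F) :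
    ∫ z, (fderiv ℝ F z 1 + Complex.I * fderiv ℝ F z Complex.I) ∂area = ∫ z, z * F z ∂arc := by
  rw [integral_area_eq, integral_arc_eq (by
    exact (continuous_id.mul hF.continuous).aestronglyMeasurable)]
  set P : ℝ × ℝ → ℂ := fun q => (q.1 : ℂ) * Complex.exp (q.2 * Complex.I)
  have hFP : ∀ p, HasFDerivAt (fun q => F (P q)) _ p := fun p =>
    ((hF.differentiable (by simp) (P p)).hasFDerivAt).comp p (hasFDerivAt_polar p)
  have hf : ∀ p, HasFDerivAt (fun q => P q * F (P q)) _ p := fun p =>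
    (hasFDerivAt_polar p).mul (hFP p)
  have hg : ∀ p : ℝ × ℝ, HasFDerivAt
      (fun q : ℝ × ℝ => Complex.I * (Complex.exp (q.2 * Complex.I) * F (P q))) _ p := fun p =>
    ((hasFDerivAt_exp_snd p).mul (hFP p)).const_mul Complex.I
  have hle : ((0, -Real.pi) : ℝ × ℝ) ≤ (1, Real.pi) :=
    ⟨zero_le_one, by simpa using by linarith [Real.pi_pos]⟩
  have hdf : ∀ e : ℂ, Continuous fun z => fderiv ℝ F z e := fun e =>
    (hF.continuous_fderiv (by simp)).clm_apply continuous_const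
  have hPc : Continuous P := by fun_prop
  have hdiv := integral_divergence_prod_Icc_of_hasFDerivAt_of_le _ _ _ _ _ _ hle
    (continuous_iff_continuousAt.2 fun p => (hf p).continuousAt).continuousOn
    (continuous_iff_continuousAt.2 fun p => (hg p).continuousAt).continuousOn
    (fun p _ => hf p) (fun p _ => hg p)
  -- The integrand, with the polar Jacobian `r`, is a divergence in `(r, θ)`.
  have key : ∀ p : ℝ × ℝ, p.1 • (fderiv ℝ F (P p) 1 + Complex.I * fderiv ℝ F (P p) Complex.I) =
      fderiv ℝ (fun q => P q * F (P q)) p (1, 0) +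
      fderiv ℝ (fun q => Complex.I * (Complex.exp (q.2 * Complex.I) * F (P q))) p (0, 1) := by
    intro p
    rw [(hf p).fderiv, (hg p).fderiv]
    set e := Complex.exp (p.2 * Complex.I) with he
    rw [← rotate_dbar (fderiv ℝ F (P p)) (Complex.norm_exp_ofReal_mul_I p.2), ← he]
    have h5 : (fderiv ℝ F (P p)) (p.1 * (e * Complex.I)) =
        p.1 * fderiv ℝ F (P p) (Complex.I * e) := by
      rw [mul_comm e, ← Complex.real_smul, map_smul, Complex.real_smul]
    simp [← he, P] at h5 ⊢
    rw [h5]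
    linear_combination (-(F (p.1 * e) * e)) * Complex.I_sq
  simp only [← (hf _).fderiv, ← (hg _).fderiv, ← key] at hdiv
  rw [hdiv ?_]
  · -- The edges `θ = ±π` cancel, and the edge `r = 0` does not contribute.
    have hpi : Complex.exp (((-Real.pi : ℝ) : ℂ) * Complex.I) =
        Complex.exp (Real.pi * Complex.I) := by
      rw [Complex.ofReal_neg, neg_mul, Complex.exp_neg, Complex.exp_pi_mul_I]
      norm_num
    simp only [P, hpi, sub_self, zero_add]
    simp [circleMap]
  · refine Continuous.integrableOn_Icc ?_
    exact (by fun_prop : Continuous fun p : ℝ × ℝ => p.1).smul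
      (((hdf _).comp hPc).add (continuous_const.mul ((hdf _).comp hPc)))

/-! ### Moments determine a function on the disk -/

theorem integrable_continuous_mul {ν : Measure ℂ} (hν : ∀ᵐ z ∂ν, z ∈ disk) {χ f : ℂ → ℂ}
    (hχ : Continuous χ) (hf : Integrable f ν) : Integrable (fun z => χ z * f z) ν := by
  obtain ⟨C, hC⟩ := (isCompact_closedBall (0 : ℂ) 1).exists_bound_of_continuousOn hχ.continuousOn
  exact hf.bdd_mul (c := C) hχ.aestronglyMeasurable (hν.mono fun z hz => hC z hz)

/-- By the Stone-Weierstrass theorem, an integrable function on the disk all of whose moments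
`∫ zᵃ z̄ᵇ f` vanish is zero almost everywhere. -/
theorem ae_eq_zero_of_moments {ν : Measure ℂ} [IsFiniteMeasure ν] (hν : ∀ᵐ z ∂ν, z ∈ disk)
    {f : ℂ → ℂ} (hf : Integrable f ν)
    (h : ∀ a b : ℕ, ∫ z, z ^ a * (starRingEnd ℂ z) ^ b * f z ∂ν = 0) : f =ᵐ[ν] 0 := by
  have : CompactSpace disk := isCompact_iff_compactSpace.1 (isCompact_closedBall 0 1)
  -- The polynomials in `z` and `z̄`, restricted to the disk.
  let S : Set C(disk, ℂ) := range fun n : ℕ × ℕ =>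
    (ContinuousMap.restrict disk (.id ℂ)) ^ n.1 * (star (ContinuousMap.restrict disk (.id ℂ))) ^ n.2
  have hmul : ∀ p ∈ Submodule.span ℂ S, ∀ q ∈ Submodule.span ℂ S,
      p * q ∈ Submodule.span ℂ S := by
    intro p hp q hq
    have := Submodule.mul_mem_mul hp hq
    rw [Submodule.span_mul_span] at this
    refine Submodule.span_mono ?_ this
    rintro _ ⟨_, ⟨m, rfl⟩, _, ⟨n, rfl⟩, rfl⟩
    refine ⟨m + n, ?_⟩
    simp only [Prod.fst_add, Prod.snd_add, pow_add]
    ring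
  have hS : ∀ q : C(disk, ℂ), q ∈ closure (Submodule.span ℂ S : Set C(disk, ℂ)) := by
    intro q
    have hsub : ∀ s, s ∈ S → s ∈ closure (Submodule.span ℂ S : Set C(disk, ℂ)) :=
      fun s hs => subset_closure (Submodule.subset_span hs)
    induction q using ContinuousMap.induction_on_of_compact with
    | const r =>
      refine subset_closure ?_
      have : ContinuousMap.const disk r = r • (1 : C(disk, ℂ)) := by ext; simp
      rw [this]
      exact Submodule.smul_mem _ _ (Submodule.subset_span ⟨(0, 0), by simp⟩)
    | id => exact hsub _ ⟨(1, 0), by simp⟩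
    | star_id => exact hsub _ ⟨(0, 1), by simp⟩
    | add p q hp hq =>
      rw [← Submodule.topologicalClosure_coe] at *
      exact Submodule.add_mem _ hp hq
    | mul p q hp hq => exact map_mem_closure₂ continuous_mul hp hq hmul
    | frequently p hp =>
      exact isClosed_closure.mem_of_frequently_of_tendsto hp tendsto_id
  have hint : ∀ P : ℂ → ℂ, Continuous P → Integrable (fun z => P z * f z) ν := fun P hP =>
    integrable_continuous_mul hν hP hf
  -- The span consists of restrictions of continuous functions on the plane; working with those
  -- avoids extending functions by zero from the disk.
  have hspan : ∀ p ∈ Submodule.span ℂ S, ∃ P : ℂ → ℂ, Continuous P ∧ (∀ z : disk, P z = p z) ∧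
      ∫ z, P z * f z ∂ν = 0 := by
    intro p hp
    induction hp using Submodule.span_induction with
    | mem p hp =>
      obtain ⟨n, rfl⟩ := hp
      exact ⟨fun z => z ^ n.1 * (starRingEnd ℂ z) ^ n.2, by fun_prop, fun z => by simp, h _ _⟩
    | zero => exact ⟨0, continuous_const, fun z => by simp, by simp⟩
    | add p q _ _ hp hq =>
      obtain ⟨P, hP, hPp, hP0⟩ := hp
      obtain ⟨Q, hQ, hQq, hQ0⟩ := hq
      refine ⟨P + Q, hP.add hQ, fun z => by simp [hPp, hQq], ?_⟩
      simp only [Pi.add_apply, add_mul]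
      rw [integral_add (hint P hP) (hint Q hQ), hP0, hQ0, add_zero]
    | smul c p _ hp =>
      obtain ⟨P, hP, hPp, hP0⟩ := hp
      refine ⟨c • P, hP.const_smul c, fun z => by simp [hPp], ?_⟩
      simp only [Pi.smul_apply, smul_mul_assoc]
      rw [integral_smul, hP0, smul_zero]
  refine ae_eq_zero_of_integral_contDiff_smul_eq_zero hf.locallyIntegrable ?_
  intro φ hφ _
  have hφ' : Continuous fun z => (φ z : ℂ) := Complex.continuous_ofReal.comp hφ.continuous
  rw [← norm_eq_zero]
  refine le_antisymm (le_of_forall_pos_le_add fun ε hε => ?_) (norm_nonneg _)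
  rw [zero_add]
  have hC : 0 ≤ ∫ z, ‖f z‖ ∂ν := integral_nonneg fun _ => norm_nonneg _
  obtain ⟨p, hp, hpε⟩ := Metric.mem_closure_iff.1
    (hS ⟨fun z : disk => (φ z : ℂ), hφ'.comp continuous_subtype_val⟩)
    (ε / ((∫ z, ‖f z‖ ∂ν) + 1)) (by positivity)
  obtain ⟨P, hP, hPp, hP0⟩ := hspan p hp
  have e1 : ∫ z, φ z • f z ∂ν = ∫ z, ((φ z : ℂ) - P z) * f z ∂ν := by
    simp only [sub_mul]
    rw [integral_sub (hint _ hφ') (hint P hP), hP0, sub_zero]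
    simp only [Complex.real_smul]
  rw [e1]
  calc ‖∫ z, ((φ z : ℂ) - P z) * f z ∂ν‖
      ≤ ∫ z, ε / ((∫ z, ‖f z‖ ∂ν) + 1) * ‖f z‖ ∂ν := by
        refine norm_integral_le_of_norm_le (hf.norm.const_mul _) ?_
        filter_upwards [hν] with z hz
        rw [norm_mul]
        gcongr
        rw [ContinuousMap.dist_lt_iff (by positivity)] at hpε
        have := hpε ⟨z, hz⟩
        rw [← hPp, dist_eq_norm] at this
        exact this.le
    _ ≤ ε := by
        rw [integral_const_mul, div_mul_eq_mul_div, div_le_iff₀ (by positivity)]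
        nlinarith

/-! ### The arc length measure -/

instance instIsFiniteMeasureArc : IsFiniteMeasure arc := by
  unfold arc
  infer_instance

theorem ae_area_mem_disk : ∀ᵐ z ∂area, z ∈ disk :=
  ae_restrict_mem measurableSet_closedBall

theorem ae_arc_norm_eq_one : ∀ᵐ z ∂arc, ‖z‖ = 1 := by
  unfold arc
  rw [ae_map_iff (continuous_circleMap 0 1).aemeasurable
    (measurableSet_eq_fun measurable_norm measurable_const)]
  exact ae_of_all _ fun θ => by simp

theorem ae_arc_mem_disk : ∀ᵐ z ∂arc, z ∈ disk := by
  filter_upwards [ae_arc_norm_eq_one] with z hz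
  simp [disk, hz]

theorem arc_real_univ : arc.real univ = 2 * Real.pi := by
  unfold arc
  rw [measureReal_def, Measure.map_apply (continuous_circleMap 0 1).measurable .univ]
  simp [Real.pi_pos.le]

/-- Inversion acts on the circle by `θ ↦ 2π - θ`, so it preserves arc length. -/
theorem measurePreserving_inv_arc : MeasurePreserving (fun z : ℂ => z⁻¹) arc arc := by
  refine ⟨measurable_inv, ?_⟩
  have h1 : MeasurePreserving (fun θ : ℝ => 2 * Real.pi - θ)
      (volume.restrict (Ioc 0 (2 * Real.pi))) (volume.restrict (Ioc 0 (2 * Real.pi))) := by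
    have := (Measure.measurePreserving_sub_left (volume : Measure ℝ)
      (2 * Real.pi)).restrict_preimage (measurableSet_Ico (a := (0 : ℝ)) (b := 2 * Real.pi))
    rw [show (fun θ : ℝ => 2 * Real.pi - θ) ⁻¹' Ico 0 (2 * Real.pi) = Ioc 0 (2 * Real.pi) by simp,
      Measure.restrict_congr_set (Ico_ae_eq_Ioc (a := (0 : ℝ)) (b := 2 * Real.pi))] at this
    exact this
  have hc := (continuous_circleMap 0 1).measurable
  have h2 : (fun z : ℂ => z⁻¹) ∘ circleMap 0 1 =
      circleMap 0 1 ∘ fun θ : ℝ => 2 * Real.pi - θ := by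
    funext θ
    simp [circleMap, sub_mul, Complex.exp_sub]
  unfold arc
  rw [Measure.map_map measurable_inv hc, h2, ← Measure.map_map hc (by fun_prop), h1.map_eq]

/-! ### Passing Stokes' theorem to the limit -/

/-- Convergence in `L²` of a finite measure on the disk implies convergence of the integrals
against a continuous function, which is bounded on the disk. -/
theorem tendsto_integral_mul {ν : Measure ℂ} [IsFiniteMeasure ν] (hν : ∀ᵐ z ∂ν, z ∈ disk)
    {χ f : ℂ → ℂ} {F : ℕ → ℂ → ℂ} (hχ : Continuous χ) (hF : ∀ k, Continuous (F k))
    (hf : MemLp f 2 ν) (t : Tendsto (fun k => eLpNorm (fun z => F k z - f z) 2 ν) atTop (𝓝 0)) :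
    Tendsto (fun k => ∫ z, χ z * F k z ∂ν) atTop (𝓝 (∫ z, χ z * f z ∂ν)) := by
  obtain ⟨C, hC⟩ := (isCompact_closedBall (0 : ℂ) 1).exists_bound_of_continuousOn hχ.continuousOn
  have hint : ∀ k, Integrable (fun z => χ z * F k z) ν := fun k => by
    simpa using integrable_continuous_mul hν (hχ.mul (hF k)) (integrable_const (1 : ℂ))
  refine tendsto_integral_of_L1' _ (hχ.aestronglyMeasurable.mul hf.1)
    (Eventually.of_forall hint) ?_
  have t' : Tendsto (fun k => ENNReal.ofReal C * (eLpNorm (fun z => F k z - f z) 2 ν *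
      ν univ ^ (1 / (1 : ℝ≥0∞).toReal - 1 / (2 : ℝ≥0∞).toReal))) atTop (𝓝 0) := by
    have hfin : ν univ ^ (1 / (1 : ℝ≥0∞).toReal - 1 / (2 : ℝ≥0∞).toReal) ≠ ⊤ :=
      ENNReal.rpow_ne_top_of_nonneg (by norm_num) (measure_ne_top ν univ)
    have := ENNReal.Tendsto.const_mul (a := ENNReal.ofReal C)
      (ENNReal.Tendsto.mul_const (b := ν univ ^ (1 / (1 : ℝ≥0∞).toReal - 1 / (2 : ℝ≥0∞).toReal))
        t (Or.inr hfin)) (Or.inr ENNReal.ofReal_ne_top)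
    simpa using this
  refine tendsto_of_tendsto_of_tendsto_of_le_of_le tendsto_const_nhds t' (fun _ => zero_le) ?_
  intro k
  have hm : AEStronglyMeasurable (fun z => F k z - f z) ν :=
    (hF k).aestronglyMeasurable.sub hf.1
  refine (eLpNorm_le_mul_eLpNorm_of_ae_le_mul (c := C) (g := fun z => F k z - f z) ?_ 1).trans ?_
  · filter_upwards [hν] with z hz
    rw [Pi.sub_apply, Pi.mul_apply, ← mul_sub, norm_mul]
    exact mul_le_mul_of_nonneg_right (hC z hz) (norm_nonneg _)
  · refine mul_le_mul_right ?_ _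
    exact eLpNorm_le_eLpNorm_mul_rpow_measure_univ (by norm_num) hm

/-- Stokes' theorem for a function `u ∈ H¹(𝔻)` with `∂̄u = 0` and trace `g`, tested against a
function `χ` smooth up to the boundary. -/
theorem HasTrace.integral_dbar_mul_eq {u g : ℂ → ℂ} (hu : HasTrace u g) {w₁ w₂ : Lp ℂ 2 area}
    (h₁ : IsWeakDeriv 1 u w₁) (h₂ : IsWeakDeriv Complex.I u w₂) (hw : w₁ + Complex.I • w₂ = 0)
    {χ : ℂ → ℂ} (hχ : ContDiff ℝ ∞ χ) :
    ∫ z, (fderiv ℝ χ z 1 + Complex.I * fderiv ℝ χ z Complex.I) * u z ∂area =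
      ∫ z, z * χ z * g z ∂arc := by
  obtain ⟨hu2, hg2, w₁', w₂', h₁', h₂', φ, hφ, t0, t1, t2, t3⟩ := hu
  obtain rfl := h₁.unique h₁'
  obtain rfl := h₂.unique h₂'
  have hd : ∀ {ψ : ℂ → ℂ} (e : ℂ), ContDiff ℝ ∞ ψ → Continuous fun z => fderiv ℝ ψ z e :=
    fun e hψ => (hψ.continuous_fderiv (by simp)).clm_apply continuous_const
  have hχd : Continuous fun z => fderiv ℝ χ z 1 + Complex.I * fderiv ℝ χ z Complex.I :=
    (hd 1 hχ).add (continuous_const.mul (hd _ hχ))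
  have hIχ : Continuous fun z => Complex.I * χ z := continuous_const.mul hχ.continuous
  have l0 := tendsto_integral_mul ae_area_mem_disk hχd (fun k => (hφ k).continuous) hu2 t0
  have l1 := tendsto_integral_mul ae_area_mem_disk hχ.continuous (fun k => hd 1 (hφ k))
    (Lp.memLp w₁) t1
  have l2 := tendsto_integral_mul ae_area_mem_disk hIχ (fun k => hd Complex.I (hφ k))
    (Lp.memLp w₂) t2
  have l3 := tendsto_integral_mul ae_arc_mem_disk (continuous_id.mul hχ.continuous)
    (fun k => (hφ k).continuous) hg2 t3
  have hi : ∀ {ψ θ : ℂ → ℂ}, Continuous ψ → Continuous θ →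
      Integrable (fun z => ψ z * θ z) area := fun hψ hθ => by
    simpa using integrable_continuous_mul ae_area_mem_disk (hψ.mul hθ) (integrable_const (1 : ℂ))
  have hk : ∀ k, ∫ z, (fderiv ℝ χ z 1 + Complex.I * fderiv ℝ χ z Complex.I) * φ k z ∂area +
      (∫ z, χ z * fderiv ℝ (φ k) z 1 ∂area +
        ∫ z, Complex.I * χ z * fderiv ℝ (φ k) z Complex.I ∂area) =
      ∫ z, z * χ z * φ k z ∂arc := fun k => by
    have hs := integral_dbar_eq (hχ.mul (hφ k))
    simp only [← mul_assoc] at hs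
    have i1 := hi hχ.continuous (hd 1 (hφ k))
    have i2 := hi hIχ (hd Complex.I (hφ k))
    rw [← hs, ← integral_add i1 i2]
    refine (integral_add (hi hχd (hφ k).continuous) (i1.add i2)).symm.trans ?_
    refine integral_congr_ae (ae_of_all _ fun z => ?_)
    have hm : fderiv ℝ (fun z => χ z * φ k z) z = χ z • fderiv ℝ (φ k) z + φ k z • fderiv ℝ χ z :=
      fderiv_fun_mul (hχ.differentiable (by simp) z) ((hφ k).differentiable (by simp) z)
    simp only [hm, Pi.add_apply, add_apply, smul_apply, smul_eq_mul]
    ring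
  have hlim := tendsto_nhds_unique ((l0.add (l1.add l2)).congr hk) l3
  -- The terms in which the derivative falls on `u` add up to `∫ χ · 2 ∂̄u = 0`.
  have hw0 : ∫ z, χ z * w₁ z ∂area + ∫ z, Complex.I * χ z * w₂ z ∂area = 0 := by
    rw [← integral_add
      (integrable_continuous_mul ae_area_mem_disk hχ.continuous
        ((Lp.memLp w₁).integrable (by norm_num)))
      (integrable_continuous_mul ae_area_mem_disk hIχ ((Lp.memLp w₂).integrable (by norm_num)))]
    refine integral_eq_zero_of_ae ?_
    have hz : ⇑(w₁ + Complex.I • w₂) =ᵐ[area] 0 := hw ▸ Lp.coeFn_zero ℂ 2 area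
    filter_upwards [hz, Lp.coeFn_add w₁ (Complex.I • w₂), Lp.coeFn_smul Complex.I w₂]
      with z h0 ha hs
    rw [ha, Pi.add_apply, hs] at h0
    simp only [Pi.smul_apply, smul_eq_mul, Pi.zero_apply] at h0 ⊢
    linear_combination χ z * h0
  rw [hw0, add_zero] at hlim
  exact hlim

/-! ### Monomials as test functions -/

theorem contDiff_monomial (a b : ℕ) :
    ContDiff ℝ ∞ fun z : ℂ => z ^ a * (starRingEnd ℂ z) ^ b :=
  (contDiff_id.pow a).mul (Complex.conjCLE.contDiff.pow b)

/-- `2 ∂̄(zᵃ z̄ᵇ) = 2b zᵃ z̄ᵇ⁻¹`; for `b = 0` the truncated exponent is harmless, as the right-hand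
side is zero. -/
theorem two_dbar_monomial (a b : ℕ) (z : ℂ) :
    fderiv ℝ (fun z : ℂ => z ^ a * (starRingEnd ℂ z) ^ b) z 1 +
      Complex.I * fderiv ℝ (fun z : ℂ => z ^ a * (starRingEnd ℂ z) ^ b) z Complex.I =
      2 * b * (z ^ a * (starRingEnd ℂ z) ^ (b - 1)) := by
  have h1 : HasFDerivAt (fun z : ℂ => z ^ a) _ z := (hasFDerivAt_id (𝕜 := ℝ) z).pow a
  have h2 : HasFDerivAt (fun z : ℂ => (starRingEnd ℂ z) ^ b) _ z :=
    (Complex.conjCLE.hasFDerivAt (x := z)).pow b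
  have h3 : fderiv ℝ (fun z : ℂ => z ^ a * (starRingEnd ℂ z) ^ b) z = _ := (h1.mul h2).fderiv
  rw [h3]
  simp
  linear_combination (-(b : ℂ) * (z ^ a * (starRingEnd ℂ z) ^ (b - 1))
    + a * (starRingEnd ℂ z) ^ b * z ^ (a - 1)) * Complex.I_sq

theorem integral_arc_pow {n : ℕ} (hn : n ≠ 0) : ∫ z, z ^ n ∂arc = 0 := by
  obtain ⟨m, rfl⟩ := Nat.exists_eq_succ_of_ne_zero hn
  have := integral_dbar_eq (contDiff_monomial m 0)
  simp only [two_dbar_monomial] at this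
  simpa [pow_succ'] using this.symm

theorem integral_arc_conj_pow {n : ℕ} (hn : n ≠ 0) :
    ∫ z, (starRingEnd ℂ z) ^ n ∂arc = 0 := by
  simp only [← map_pow]
  rw [integral_conj, integral_arc_pow hn, map_zero]

/-- A function on the circle whose nonzero Fourier coefficients all vanish is constant. -/
theorem ae_arc_eq_const {g : ℂ → ℂ} (hg : Integrable g arc)
    (hpos : ∀ n : ℕ, n ≠ 0 → ∫ z, z ^ n * g z ∂arc = 0)
    (hneg : ∀ n : ℕ, n ≠ 0 → ∫ z, (starRingEnd ℂ z) ^ n * g z ∂arc = 0) :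
    ∃ c : ℂ, ∀ᵐ z ∂arc, g z = c := by
  have hpi : (2 * Real.pi : ℂ) ≠ 0 := by simp [Real.pi_ne_zero]
  set c : ℂ := (2 * Real.pi : ℂ)⁻¹ * ∫ z, g z ∂arc with hc
  refine ⟨c, ?_⟩
  have hsub : ∀ χ : ℂ → ℂ, Continuous χ →
      ∫ z, χ z * (g z - c) ∂arc = ∫ z, χ z * g z ∂arc - (∫ z, χ z ∂arc) * c := by
    intro χ hχ
    simp only [mul_sub]
    rw [integral_sub (integrable_continuous_mul ae_arc_mem_disk hχ hg)
      (integrable_continuous_mul ae_arc_mem_disk hχ (integrable_const c)), integral_mul_const]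
  have h := ae_eq_zero_of_moments ae_arc_mem_disk (f := fun z => g z - c)
    (hg.sub (integrable_const c)) ?_
  · filter_upwards [h] with z hz using sub_eq_zero.1 hz
  intro a b
  -- On the circle `zᵃ z̄ᵇ` is a power of `z` or of `z̄`.
  have hz : ∀ᵐ z ∂arc, z * starRingEnd ℂ z = 1 := by
    filter_upwards [ae_arc_norm_eq_one] with z hz
    rw [Complex.mul_conj, Complex.normSq_eq_norm_sq, hz]
    simp
  rcases lt_trichotomy a b with hab | rfl | hab
  · obtain ⟨n, rfl⟩ := Nat.exists_eq_add_of_le hab.le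
    have hn : n ≠ 0 := by omega
    rw [integral_congr_ae (g := fun z => (starRingEnd ℂ z) ^ n * (g z - c)),
      hsub _ (by fun_prop), hneg n hn, integral_arc_conj_pow hn, zero_mul, sub_zero]
    filter_upwards [hz] with z hz
    rw [pow_add, ← mul_assoc (z ^ a), ← mul_pow, hz, one_pow, one_mul]
  · rw [integral_congr_ae (g := fun z => 1 * (g z - c)), hsub _ continuous_const]
    · have h1 : ∫ _ : ℂ, (1 : ℂ) ∂arc = 2 * Real.pi := by
        rw [integral_const, arc_real_univ]
        simp
      rw [h1, hc, mul_inv_cancel_left₀ hpi]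
      simp
    · filter_upwards [hz] with z hz
      rw [← mul_pow, hz, one_pow]
  · obtain ⟨n, rfl⟩ := Nat.exists_eq_add_of_le hab.le
    have hn : n ≠ 0 := by omega
    rw [integral_congr_ae (g := fun z => z ^ n * (g z - c)),
      hsub _ (by fun_prop), hpos n hn, integral_arc_pow hn, zero_mul, sub_zero]
    filter_upwards [hz] with z hz
    rw [pow_add, mul_right_comm (z ^ b), ← mul_pow, hz, one_pow, one_mul]

/-- The trace of a function in the kernel of `∂̄` has no Fourier modes of negative frequency. -/
theorem HasTrace.integral_pow_mul_eq_zero {u g : ℂ → ℂ} (hu : HasTrace u g) {w₁ w₂ : Lp ℂ 2 area}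
    (h₁ : IsWeakDeriv 1 u w₁) (h₂ : IsWeakDeriv Complex.I u w₂) (hw : w₁ + Complex.I • w₂ = 0)
    {n : ℕ} (hn : n ≠ 0) : ∫ z, z ^ n * g z ∂arc = 0 := by
  obtain ⟨m, rfl⟩ := Nat.exists_eq_succ_of_ne_zero hn
  have := hu.integral_dbar_mul_eq h₁ h₂ hw (contDiff_monomial m 0)
  simp only [two_dbar_monomial] at this
  simpa [pow_succ'] using this.symm

/-- A function in the kernel of `∂̄` with constant trace is constant: by Stokes' theorem it has the
same moments as the constant, since every monomial is `∂̄` of a monomial. -/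
theorem HasTrace.ae_eq_const {u g : ℂ → ℂ} (hu : HasTrace u g) {w₁ w₂ : Lp ℂ 2 area}
    (h₁ : IsWeakDeriv 1 u w₁) (h₂ : IsWeakDeriv Complex.I u w₂) (hw : w₁ + Complex.I • w₂ = 0)
    {c : ℂ} (hg : ∀ᵐ z ∂arc, g z = c) : ∀ᵐ z ∂area, u z = c := by
  have hui : Integrable u area := hu.1.integrable (by norm_num)
  have h := ae_eq_zero_of_moments ae_area_mem_disk (f := fun z => u z - c)
    (hui.sub (integrable_const c)) ?_
  · filter_upwards [h] with z hz using sub_eq_zero.1 hz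
  intro a b
  have hM := contDiff_monomial a (b + 1)
  have e1 := hu.integral_dbar_mul_eq h₁ h₂ hw hM
  have e2 := integral_dbar_eq hM
  simp only [two_dbar_monomial, Nat.add_sub_cancel] at e1 e2
  have e3 : ∫ z, z * (z ^ a * (starRingEnd ℂ z) ^ (b + 1)) * g z ∂arc =
      (∫ z, z * (z ^ a * (starRingEnd ℂ z) ^ (b + 1)) ∂arc) * c := by
    rw [← integral_mul_const]
    refine integral_congr_ae ?_
    filter_upwards [hg] with z hz
    rw [hz]
  rw [e3, ← e2] at e1
  simp only [mul_assoc (2 * ((b + 1 : ℕ) : ℂ))] at e1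
  rw [integral_const_mul, integral_const_mul, mul_assoc (2 * ((b + 1 : ℕ) : ℂ))] at e1
  have hb : (2 * ((b + 1 : ℕ) : ℂ)) ≠ 0 := by
    simpa using Nat.cast_add_one_ne_zero (R := ℂ) b
  have e4 := mul_left_cancel₀ hb e1
  have hχ := (contDiff_monomial a b).continuous
  simp only [mul_sub]
  rw [integral_sub (integrable_continuous_mul ae_area_mem_disk hχ hui)
    (integrable_continuous_mul ae_area_mem_disk hχ (integrable_const c)), integral_mul_const,
    e4, sub_self]

/-! ### The kernel -/

/-- Functions annihilated by `∂̄` on the two hemispheres whose traces match under inversion are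
equal to the same constant: matching kills the Fourier modes of either sign. -/
theorem ae_eq_const_of_matching {u v g h : ℂ → ℂ} (hu : HasTrace u g) (hv : HasTrace v h)
    (hgh : ∀ᵐ z ∂arc, g z = h (1 / z)) {w₁ w₂ y₁ y₂ : Lp ℂ 2 area}
    (h₁ : IsWeakDeriv 1 u w₁) (h₂ : IsWeakDeriv Complex.I u w₂) (hw : w₁ + Complex.I • w₂ = 0)
    (k₁ : IsWeakDeriv 1 v y₁) (k₂ : IsWeakDeriv Complex.I v y₂) (hy : y₁ + Complex.I • y₂ = 0) :
    ∃ c : ℂ, (∀ᵐ z ∂area, u z = c) ∧ ∀ᵐ z ∂area, v z = c := by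
  simp only [one_div] at hgh
  have hinv := measurePreserving_inv_arc
  obtain ⟨c, hc⟩ := ae_arc_eq_const (hu.2.1.integrable (by norm_num))
    (fun n hn => hu.integral_pow_mul_eq_zero h₁ h₂ hw hn) fun n hn => by
      have hm : AEStronglyMeasurable (fun z => z ^ n * h z) (arc.map fun z => z⁻¹) := by
        rw [hinv.map_eq]
        exact (continuous_pow n).aestronglyMeasurable.mul hv.2.1.1
      rw [← hv.integral_pow_mul_eq_zero k₁ k₂ hy hn]
      nth_rw 2 [← hinv.map_eq]
      rw [integral_map hinv.aemeasurable hm]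
      refine integral_congr_ae ?_
      filter_upwards [hgh, ae_arc_norm_eq_one] with z hz hz1
      rw [hz, RCLike.inv_eq_conj hz1]
  refine ⟨c, hu.ae_eq_const h₁ h₂ hw hc, hv.ae_eq_const k₁ k₂ hy ?_⟩
  filter_upwards [hinv.quasiMeasurePreserving.ae hc, hinv.quasiMeasurePreserving.ae hgh]
    with z hz1 hz2
  rw [hz1, inv_inv] at hz2
  exact hz2.symm

theorem isWeakDeriv_const (e c : ℂ) :
    IsWeakDeriv e (fun _ => c) (0 : Lp ℂ 2 area) := by
  suffices IsWeakDeriv e (fun _ => c) 0 from this.congr .rfl (Lp.coeFn_zero ℂ 2 area).symm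
  intro φ h1 h2 h3
  have hd : Continuous fun z => fderiv ℝ φ z e :=
    (h1.continuous_fderiv (by simp)).clm_apply continuous_const
  have hdc : HasCompactSupport fun z => fderiv ℝ φ z e := h2.fderiv_apply (𝕜 := ℝ) e
  have h0 : ∫ z, fderiv ℝ φ z e = 0 := by
    have := integral_mul_fderiv_eq_neg_fderiv_mul_of_integrable (μ := (volume : Measure ℂ))
      (f := fun _ => (1 : ℝ)) (g := φ) (v := e) (by simp)
      (by simpa using hd.integrable_of_hasCompactSupport hdc)
      (by simpa using h1.continuous.integrable_of_hasCompactSupport h2)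
      (fun _ _ => by fun_prop) (fun _ _ => h1.differentiable (by simp) _)
    simpa using this
  have h4 : ∫ z, fderiv ℝ φ z e ∂area = ∫ z, fderiv ℝ φ z e := by
    refine setIntegral_eq_integral_of_forall_compl_eq_zero fun z hz => ?_
    have : z ∉ tsupport (fderiv ℝ φ) := fun hz' =>
      hz (Metric.ball_subset_closedBall (h3 (tsupport_fderiv_subset ℝ hz')))
    rw [image_eq_zero_of_notMem_tsupport this]
    rfl
  rw [integral_smul_const, h4, h0]
  simp

theorem hasTrace_const (c : ℂ) : HasTrace (fun _ => c) fun _ => c := by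
  refine ⟨memLp_const c, memLp_const c, 0, 0, isWeakDeriv_const _ c, isWeakDeriv_const _ c,
    fun _ _ => c, fun _ => contDiff_const, by simp, ?_, ?_, by simp⟩ <;>
  · refine tendsto_const_nhds.congr fun k => ?_
    rw [← eLpNorm_zero (ε := ℂ) (p := 2) (μ := area)]
    refine eLpNorm_congr_ae ?_
    filter_upwards [Lp.coeFn_zero ℂ 2 area] with z hz
    rw [hz]
    simp

theorem memH1_const (c : ℂ) : MemH1 fun _ => c :=
  ⟨memLp_const c, ⟨0, isWeakDeriv_const _ c⟩, ⟨0, isWeakDeriv_const _ c⟩⟩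

theorem dbar_eq_zero_iff (u : H1) : dbar u = 0 ↔ partialX u + Complex.I • partialY u = 0 := by
  change (1 / 2 : ℂ) • (partialX u + Complex.I • partialY u) = 0 ↔ _
  simp only [smul_eq_zero, one_div, inv_eq_zero, OfNat.ofNat_ne_zero, false_or]

theorem dbar_eq_zero_of_ae_eq_const (u : H1) {c : ℂ} (h : ∀ᵐ z ∂area, u.1 z = c) :
    dbar u = 0 := by
  have hX : partialX u = 0 :=
    u.2.2.1.choose_spec.unique ((isWeakDeriv_const 1 c).congr (h.mono fun _ hz => hz.symm) .rfl)
  have hY : partialY u = 0 :=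
    u.2.2.2.choose_spec.unique
      ((isWeakDeriv_const Complex.I c).congr (h.mono fun _ hz => hz.symm) .rfl)
  rw [dbar_eq_zero_iff, hX, hY, smul_zero, add_zero]

theorem fsArea_ac : fsArea ≪ area := withDensity_absolutelyContinuous _ _

instance instIsFiniteMeasureFsArea : IsFiniteMeasure fsArea := by
  refine ⟨lt_of_le_of_lt ?_ (measure_lt_top area univ)⟩
  rw [fsArea, withDensity_apply _ .univ, Measure.restrict_univ]
  calc ∫⁻ z, ENNReal.ofReal (1 / (1 + ‖z‖ ^ 2) ^ 2) ∂area ≤ ∫⁻ _, 1 ∂area := by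
        refine lintegral_mono fun z => ?_
        rw [← ENNReal.ofReal_one]
        refine ENNReal.ofReal_le_ofReal ?_
        rw [div_le_one (by positivity)]
        nlinarith [sq_nonneg ‖z‖, sq_nonneg (‖z‖ ^ 2)]
    _ = area univ := by simp

theorem fsArea_ne_zero : fsArea ≠ 0 := by
  intro h
  have : area univ = 0 := area_ac (by simp [h])
  simp [area, disk, NNReal.pi_ne_zero] at this

theorem mem_kerD_iff (x : Functions) :
    x ∈ kerD ↔ ∃ c : ℂ, (∀ᵐ z ∂fsArea, x.fst z = c) ∧ (∀ᵐ z ∂fsArea, x.snd z = c) := by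
  constructor
  · rintro ⟨⟨y, hy⟩, h0, rfl⟩
    obtain ⟨hu, hv, g, h, hg, hh, hgh⟩ := id hy
    have h1 : WithLp.toLp 2 (dbar ⟨y.fst, hu⟩, dbar ⟨y.snd, hv⟩) = (0 : Forms) := h0
    rw [WithLp.toLp_eq_zero, Prod.mk_eq_zero, dbar_eq_zero_iff, dbar_eq_zero_iff] at h1
    obtain ⟨c, hc1, hc2⟩ := ae_eq_const_of_matching hg hh hgh
      hu.2.1.choose_spec hu.2.2.choose_spec h1.1 hv.2.1.choose_spec hv.2.2.choose_spec h1.2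
    exact ⟨c, fsArea_ac.ae_le hc1, fsArea_ac.ae_le hc2⟩
  · rintro ⟨c, h1, h2⟩
    have h1' : ∀ᵐ z ∂area, x.fst z = c := area_ac.ae_le h1
    have h2' : ∀ᵐ z ∂area, x.snd z = c := area_ac.ae_le h2
    have e1 : (fun _ => c) =ᵐ[area] x.fst := h1'.mono fun _ hz => hz.symm
    have e2 : (fun _ => c) =ᵐ[area] x.snd := h2'.mono fun _ hz => hz.symm
    have hx : x ∈ dom := ⟨(memH1_const c).congr e1, (memH1_const c).congr e2, fun _ => c,
      fun _ => c, (hasTrace_const c).congr e1, (hasTrace_const c).congr e2,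
      ae_of_all _ fun _ => rfl⟩
    refine ⟨⟨x, hx⟩, ?_, rfl⟩
    change WithLp.toLp 2 (dbar ⟨x.fst, hx.1⟩, dbar ⟨x.snd, hx.2.1⟩) = (0 : Forms)
    rw [dbar_eq_zero_of_ae_eq_const _ h1', dbar_eq_zero_of_ae_eq_const _ h2']
    rfl

/-- The constant function `c` on the sphere. -/
def constFunction (c : ℂ) : Functions := WithLp.toLp 2 (Lp.const 2 fsArea c, Lp.const 2 fsArea c)

theorem mem_kerD_iff_eq_constFunction (x : Functions) :
    x ∈ kerD ↔ ∃ c : ℂ, x = constFunction c := by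
  rw [mem_kerD_iff]
  refine exists_congr fun c => ⟨fun ⟨h1, h2⟩ => ?_, ?_⟩
  · refine WithLp.ofLp_injective 2 (Prod.ext (Lp.ext ?_) (Lp.ext ?_))
    · filter_upwards [h1, Lp.coeFn_const 2 fsArea c] with z hz hz' using hz.trans hz'.symm
    · filter_upwards [h2, Lp.coeFn_const 2 fsArea c] with z hz hz' using hz.trans hz'.symm
  · rintro rfl
    exact ⟨Lp.coeFn_const 2 fsArea c, Lp.coeFn_const 2 fsArea c⟩

theorem finrank_kerD : Module.finrank ℂ kerD = 1 := by
  have hne : constFunction 1 ≠ 0 := by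
    intro h
    have h1 : Lp.const 2 fsArea (1 : ℂ) = 0 := congrArg (fun x : Functions => x.fst) h
    have h2 : ∀ᵐ _ ∂fsArea, (1 : ℂ) = 0 := by
      filter_upwards [Lp.coeFn_const 2 fsArea (1 : ℂ), Lp.coeFn_zero ℂ 2 fsArea]
        with z hz hz0
      rw [h1, hz0] at hz
      exact hz.symm
    exact fsArea_ne_zero (by simpa using h2)
  have hmem : constFunction 1 ∈ kerD := (mem_kerD_iff_eq_constFunction _).2 ⟨1, rfl⟩
  refine finrank_eq_one ⟨constFunction 1, hmem⟩ (fun h => hne (congrArg Subtype.val h)) ?_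
  rintro ⟨x, hx⟩
  obtain ⟨c, rfl⟩ := (mem_kerD_iff_eq_constFunction _).1 hx
  refine ⟨c, Subtype.ext ?_⟩
  -- `Lp.constL` is `Lp.const` with its linearity.
  have h3 : c • Lp.const 2 fsArea (1 : ℂ) = Lp.const 2 fsArea c := by
    have := (Lp.constL 2 fsArea ℂ).map_smul c (1 : ℂ)
    simpa using this.symm
  exact WithLp.ofLp_injective 2 (Prod.ext h3 h3)

end GluedSphere

end

theorem mainTheorem7 :
    Module.finrank ℂ GluedSphere.kerD = 1 ∧
    ∀ x : GluedSphere.Functions, x ∈ GluedSphere.kerD ↔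
      ∃ c : ℂ, (∀ᵐ z ∂GluedSphere.fsArea, x.fst z = c) ∧
        (∀ᵐ z ∂GluedSphere.fsArea, x.snd z = c) :=
  ⟨GluedSphere.finrank_kerD, GluedSphere.mem_kerD_iff⟩
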